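/- Let $p$ be an odd prime, let $n\ge 0$, let $K=\mathrm{GL}_n(\mathbb{Z}_p)$, and fix a unit $r\in\mathbb{Z}_p^\times$ that is not a square. Let $X$ be a random symmetric $n\times n$ matrix over $\mathbb{Z}_p$ whose entries $X_{ij}$, $1\le i\le j\le n$, are independent and distributed according to the Haar probability measure on $\mathbb{Z}_p$. Write $\mathbf{1}_m^{+}$ for the $m\times m$ identity matrix and $\mathbf{1}_m^{-}$ for the identity matrix with its last diagonal entry replaced by $r$. Let $0\le k_1\le k_2\le\dots\le k_n$ be integers, $\Sigma=\mathrm{diag}(p^{k_1},\dots,p^{k_n})$, and $m_k=\#\{i:k_i=k\}$ for $k\ge 0$. For each $k\ge0$ let $s_k\in\{+,-\}$ be a sign, with $s_k=+$ whenever $m_k=0$, and let $S=\mathrm{diag}(\mathbf{1}_{m_0}^{s_0},\mathbf{1}_{m_1}^{s_1},\dots)$ be the corresponding canonical matrix of signatures. Then $$\mathbb{P}\{X\in K\Sigma SK^\top\}=\frac{\pi_n}{\prod_{k\ge 0}\alpha_{m_k}^{s_k}}\prod_{j=1}^{n}p^{-k_j(n-j+1)},$$ where $K\Sigma SK^\top=\{U\Sigma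 SU^\top: U\in K\}$, $\pi_n=p^{-n^2}|\mathrm{GL}_n(\mathbb{F}_p)|$, and $\alpha_m^s=p^{-m(m-1)/2}|\mathrm{O}_m^s(\mathbb{F}_p)|$ with $\mathrm{O}_m^s(\mathbb{F}_p)=\{g\in \mathrm{GL}_m(\mathbb{F}_p): g\,\mathbf{1}_m^s\,g^\top=\mathbf{1}_m^s\}$ (the entry $r$ being reduced modulo $p$); in particular $\pi_0=1$ and $\alpha_0^{+}=1$, so only finitely many factors of the product over $k$ differ from $1$. -/

import Mathlib

open MeasureTheory ProbabilityTheory Matrix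

noncomputable section

namespace PadicSymm

instance instMeasurableSpacePadicInt (p : ℕ) [Fact p.Prime] : MeasurableSpace ℤ_[p] :=
  borel ℤ_[p]

instance instBorelSpacePadicInt (p : ℕ) [Fact p.Prime] : BorelSpace ℤ_[p] := ⟨rfl⟩

/-- The Haar measure on the additive group of `ℤ_p`, normalised to have total mass one. -/
def haar (p : ℕ) [Fact p.Prime] : Measure ℤ_[p] :=
  Measure.addHaarMeasure ⊤

instance instIsProbabilityMeasureHaar (p : ℕ) [Fact p.Prime] :
    IsProbabilityMeasure (haar p) :=
  ⟨by simpa [haar] using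
    Measure.addHaarMeasure_self (K₀ := (⊤ : TopologicalSpace.PositiveCompacts ℤ_[p]))⟩

/-- The canonical block of size `m`, sign `s` and distinguished element `r`: the identity matrix
if `s = 1`, and the identity matrix with last diagonal entry replaced by `r` if `s = -1`. -/
def signBlock {R : Type*} [CommRing R] (r : R) (m : ℕ) (s : ℤˣ) : Matrix (Fin m) (Fin m) R :=
  diagonal fun i => if s = -1 ∧ (i : ℕ) + 1 = m then r else 1

/-- The stabiliser of a square matrix `A` under the congruence action of `GL_m(R)`. -/
def congrStabilizer {R : Type*} [CommRing R] {m : ℕ} (A : Matrix (Fin m) (Fin m) R) :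
    Subgroup (GL (Fin m) R) where
  carrier := {g | (g : Matrix (Fin m) (Fin m) R) * A * (g : Matrix (Fin m) (Fin m) R)ᵀ = A}
  one_mem' := by simp
  mul_mem' := by
    intro a b ha hb
    simp only [Set.mem_ofPred_eq, Units.val_mul, transpose_mul] at ha hb ⊢
    calc (a : Matrix (Fin m) (Fin m) R) * b * A * ((b : Matrix (Fin m) (Fin m) R)ᵀ
            * (a : Matrix (Fin m) (Fin m) R)ᵀ)
        = a * (b * A * (b : Matrix (Fin m) (Fin m) R)ᵀ) * (a : Matrix (Fin m) (Fin m) R)ᵀ := by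
          simp only [Matrix.mul_assoc]
      _ = A := by rw [hb, ha]
  inv_mem' := by
    intro a ha
    simp only [Set.mem_ofPred_eq] at ha ⊢
    have h1 : ((a⁻¹ : GL (Fin m) R) : Matrix (Fin m) (Fin m) R) * a = 1 := a.inv_mul
    have h2 : (a : Matrix (Fin m) (Fin m) R)ᵀ
        * ((a⁻¹ : GL (Fin m) R) : Matrix (Fin m) (Fin m) R)ᵀ = 1 := by
      rw [← transpose_mul, h1, transpose_one]
    calc ((a⁻¹ : GL (Fin m) R) : Matrix (Fin m) (Fin m) R) * A
            * ((a⁻¹ : GL (Fin m) R) : Matrix (Fin m) (Fin m) R)ᵀ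
        = ((a⁻¹ : GL (Fin m) R) : Matrix (Fin m) (Fin m) R)
            * (a * A * (a : Matrix (Fin m) (Fin m) R)ᵀ)
            * ((a⁻¹ : GL (Fin m) R) : Matrix (Fin m) (Fin m) R)ᵀ := by rw [ha]
      _ = (((a⁻¹ : GL (Fin m) R) : Matrix (Fin m) (Fin m) R) * a) * A
            * ((a : Matrix (Fin m) (Fin m) R)ᵀ
              * ((a⁻¹ : GL (Fin m) R) : Matrix (Fin m) (Fin m) R)ᵀ) := by
          simp only [Matrix.mul_assoc]
      _ = A := by rw [h1, h2, Matrix.one_mul, Matrix.mul_one]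

/-- The orthogonal group `O_m^s(R)`, the stabiliser of the canonical block of sign `s`. -/
def orthGroup {R : Type*} [CommRing R] (r : R) (m : ℕ) (s : ℤˣ) : Subgroup (GL (Fin m) R) :=
  congrStabilizer (signBlock r m s)

/-- The density `π_n` of invertible matrices over `𝔽_p`. -/
def glDensity (p n : ℕ) : ℝ :=
  (Nat.card (GL (Fin n) (ZMod p)) : ℝ) / (p : ℝ) ^ (n ^ 2)

/-- The density `α_m^s` of the orthogonal group over `𝔽_p`; `r` is a non-square unit of `ℤ_p`,
used through its residue. It equals `1` for `m = 0`. -/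
def orthDensity (p : ℕ) [Fact p.Prime] (r : ℤ_[p]) (m : ℕ) (s : ℤˣ) : ℝ :=
  (Nat.card (orthGroup (PadicInt.toZMod r) m s) : ℝ) / (p : ℝ) ^ (m * (m - 1) / 2)

/-- The multiplicity `m_t` of `t` among the exponents `k`. -/
def mult {n : ℕ} (k : Fin n → ℕ) (t : ℕ) : ℕ :=
  (Finset.univ.filter fun i => k i = t).card

/-- The matrix of elementary divisors `diag(p^{k_1}, …, p^{k_n})`. -/
def divisorMatrix (p : ℕ) [Fact p.Prime] {n : ℕ} (k : Fin n → ℕ) :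
    Matrix (Fin n) (Fin n) ℤ_[p] :=
  diagonal fun i => (p : ℤ_[p]) ^ k i

/-- For nondecreasing `k`, the block diagonal matrix with consecutive blocks
`signBlock r (mult k t) (s t)` for `t = 0, 1, 2, …`: the diagonal entry is `r` at the last index
of each block of sign `-1`, and `1` elsewhere. -/
def signatureMatrix {p : ℕ} [Fact p.Prime] (r : ℤ_[p]) {n : ℕ} (k : Fin n → ℕ) (s : ℕ → ℤˣ) :
    Matrix (Fin n) (Fin n) ℤ_[p] :=
  diagonal fun i => if s (k i) = -1 ∧ ∀ j, k j = k i → j ≤ i then r else 1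

/-- The orbit `K A Kᵀ` of `A` under congruence by `K = GL_n(R)`. -/
def congrOrbit {R : Type*} [CommRing R] {n : ℕ} (A : Matrix (Fin n) (Fin n) R) :
    Set (Matrix (Fin n) (Fin n) R) :=
  {X | ∃ U : GL (Fin n) R,
    X = (U : Matrix (Fin n) (Fin n) R) * A * (U : Matrix (Fin n) (Fin n) R)ᵀ}

/-- `X` is a random symmetric matrix whose entries on and above the diagonal are independent and
distributed according to the Haar measure on `ℤ_p`. -/
structure IsHaarSymmetric {p : ℕ} [Fact p.Prime] {n : ℕ} {Ω : Type*} [MeasurableSpace Ω]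
    (X : Ω → Matrix (Fin n) (Fin n) ℤ_[p]) (P : Measure Ω) : Prop where
  symm : ∀ ω, (X ω).IsSymm
  law : ∀ i j, i ≤ j → HasLaw (fun ω => X ω i j) (haar p) P
  indep : iIndepFun (fun (e : {e : Fin n × Fin n // e.1 ≤ e.2}) ω => X ω e.1.1 e.1.2) P

end PadicSymm

end

/-! The measure of a congruence class is computed by peeling off one unimodular block at a time.
Group the indices of exponent 0 and write the target as diag(u, pA), with u unimodular of size a and
A of size b. Modulo p, a matrix congruent to it lies in the `GL (α ⊕ β) (ZMod p)`-orbit of diag(ū,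
0). Orbit–stabiliser counts these residues: the stabiliser consists of block upper triangular
matrices, with an isometry of ū, an arbitrary element of GL_b and an arbitrary corner
(`card_stabilizer_symBlock`). All residues of the orbit contribute equally, since Haar measure is
invariant under congruence. It suffices to treat X = diag(u, 0) + pY with Y Haar distributed.
Clearing the off-diagonal blocks leaves diag(u + pY₁₁, pS), where pS is the Schur complement. As p
is odd, a Hensel argument gives u + pY₁₁ ~ u, and cancellation gives diag(u, pA) ~ diag(u, pS) if
and only if A ~ S (`isCongr_fromBlocks_iff`). Moreover S is again Haar distributed, because a
translation of Y₂₂ translates S (`measurePreserving_schurMap`). Thus the measure of the class of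
diag(u, pA) is an explicit factor times that of the class of A (`symHaar_congrClass_symBlock`). On
iterating, the orders of GL_b telescope, each block leaves one orthogonal density, and level t
leaves p to the power −C(M+1, 2) with M = #{i : t < k i}; these exponents sum to Σ k_j (n − j + 1).
-/

noncomputable section

namespace PadicSymm

/-! ### Congruence of matrices over a commutative ring -/

section Congruence

variable {R : Type*} [CommRing R] {ι κ : Type*} [Fintype ι] [DecidableEq ι]
  [Fintype κ] [DecidableEq κ]

/-- Congruence of square matrices under the general linear group. -/
def IsCongr (A B : Matrix ι ι R) : Prop :=
  ∃ U : GL ι R, B = (U : Matrix ι ι R) * A * (U : Matrix ι ι R)ᵀ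

theorem IsCongr.refl (A : Matrix ι ι R) : IsCongr A A := ⟨1, by simp⟩

theorem IsCongr.of_isUnit_det {A U : Matrix ι ι R} (h : IsUnit U.det) :
    IsCongr A (U * A * Uᵀ) :=
  ⟨GeneralLinearGroup.mk'' U h, rfl⟩

theorem IsCongr.trans {A B C : Matrix ι ι R} (h : IsCongr A B) (h' : IsCongr B C) :
    IsCongr A C := by
  obtain ⟨U, rfl⟩ := h
  obtain ⟨V, rfl⟩ := h'
  exact ⟨V * U, by simp [Matrix.mul_assoc]⟩

theorem IsCongr.symm {A B : Matrix ι ι R} (h : IsCongr A B) : IsCongr B A := by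
  obtain ⟨U, rfl⟩ := h
  refine ⟨U⁻¹, ?_⟩
  have h1 : ((U⁻¹ : GL ι R) : Matrix ι ι R) * U = 1 := U.inv_mul
  have h2 : (U : Matrix ι ι R)ᵀ * ((U⁻¹ : GL ι R) : Matrix ι ι R)ᵀ = 1 := by
    rw [← transpose_mul, h1, transpose_one]
  calc A = (((U⁻¹ : GL ι R) : Matrix ι ι R) * U) * A *
        ((U : Matrix ι ι R)ᵀ * ((U⁻¹ : GL ι R) : Matrix ι ι R)ᵀ) := by
        rw [h1, h2, Matrix.one_mul, Matrix.mul_one]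
    _ = _ := by simp only [Matrix.mul_assoc]

theorem IsCongr.smul {A B : Matrix ι ι R} (h : IsCongr A B) (c : R) :
    IsCongr (c • A) (c • B) := by
  obtain ⟨U, rfl⟩ := h
  exact ⟨U, by simp⟩

theorem IsCongr.isSymm {A B : Matrix ι ι R} (h : IsCongr A B) (hA : A.IsSymm) : B.IsSymm := by
  obtain ⟨U, rfl⟩ := h
  simp [Matrix.IsSymm, Matrix.mul_assoc, hA.eq]

theorem IsCongr.fromBlocks {A A' : Matrix ι ι R} {B B' : Matrix κ κ R}
    (hA : IsCongr A A') (hB : IsCongr B B') :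
    IsCongr (fromBlocks A 0 0 B) (fromBlocks A' 0 0 B') := by
  obtain ⟨U, rfl⟩ := hA
  obtain ⟨V, rfl⟩ := hB
  have h : IsUnit (Matrix.fromBlocks (U : Matrix ι ι R) 0 0 (V : Matrix κ κ R)).det := by
    rw [det_fromBlocks_zero₂₁]
    exact ((isUnit_iff_isUnit_det _).1 U.isUnit).mul ((isUnit_iff_isUnit_det _).1 V.isUnit)
  simpa [fromBlocks_transpose, fromBlocks_multiply] using
    IsCongr.of_isUnit_det (A := Matrix.fromBlocks A 0 0 B) h

theorem IsCongr.map {S : Type*} [CommRing S] (f : R →+* S) {A B : Matrix ι ι R}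
    (h : IsCongr A B) : IsCongr (A.map f) (B.map f) := by
  obtain ⟨U, rfl⟩ := h
  exact ⟨GeneralLinearGroup.map f U, by
    simp [Matrix.map_mul, transpose_map, GeneralLinearGroup.map]⟩

theorem IsCongr.submatrix (e : κ ≃ ι) {A B : Matrix ι ι R} (h : IsCongr A B) :
    IsCongr (A.submatrix e e) (B.submatrix e e) := by
  obtain ⟨U, rfl⟩ := h
  have h : IsUnit ((U : Matrix ι ι R).submatrix e e).det := by
    rw [det_submatrix_equiv_self]
    exact (isUnit_iff_isUnit_det _).1 U.isUnit
  simpa [transpose_submatrix, submatrix_mul_equiv] using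
    IsCongr.of_isUnit_det (A := A.submatrix e e) h

theorem isCongr_submatrix_iff (e : κ ≃ ι) {A B : Matrix ι ι R} :
    IsCongr (A.submatrix e e) (B.submatrix e e) ↔ IsCongr A B :=
  ⟨fun h => by simpa using h.submatrix e.symm, fun h => h.submatrix e⟩

/-- Elimination of the off-diagonal blocks of a symmetric block matrix. -/
theorem isCongr_schur {A : Matrix ι ι R} (hA : A.IsSymm) (h : IsUnit A.det)
    (B : Matrix ι κ R) (C : Matrix κ κ R) :
    IsCongr (fromBlocks A 0 0 (C - Bᵀ * A⁻¹ * B)) (fromBlocks A B Bᵀ C) := by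
  have hi : A⁻¹ᵀ = A⁻¹ := by rw [transpose_nonsing_inv, hA.eq]
  have hU : IsUnit (Matrix.fromBlocks (1 : Matrix ι ι R) 0 (Bᵀ * A⁻¹) (1 : Matrix κ κ R)).det := by
    simp
  convert IsCongr.of_isUnit_det (A := Matrix.fromBlocks A 0 0 (C - Bᵀ * A⁻¹ * B)) hU using 1
  simp [fromBlocks_transpose, fromBlocks_multiply, hi, Matrix.mul_assoc,
    nonsing_inv_mul _ h, mul_nonsing_inv_cancel_left _ _ h]

end Congruence

/-! ### Hensel lifting and cancellation of unimodular blocks over ℤ_p -/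

section Padic

variable {p : ℕ} [Fact p.Prime] {ι κ : Type*} [Fintype ι] [DecidableEq ι]
  [Fintype κ] [DecidableEq κ]

theorem norm_matrix_mul_apply_le_left {ι κ l : Type*} [Fintype κ] {M : Matrix ι κ ℤ_[p]}
    (N : Matrix κ l ℤ_[p]) {c : ℝ} (hc : 0 ≤ c) (h : ∀ i j, ‖M i j‖ ≤ c) (i : ι) (j : l) :
    ‖(M * N) i j‖ ≤ c := by
  rw [Matrix.mul_apply]
  refine IsUltrametricDist.norm_sum_le_of_forall_le_of_nonneg hc fun t _ => ?_
  rw [norm_mul]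
  exact (mul_le_of_le_one_right (norm_nonneg _) (PadicInt.norm_le_one _)).trans (h i t)

theorem norm_matrix_mul_apply_le_right {ι κ l : Type*} [Fintype κ] (M : Matrix ι κ ℤ_[p])
    {N : Matrix κ l ℤ_[p]} {c : ℝ} (hc : 0 ≤ c) (h : ∀ i j, ‖N i j‖ ≤ c) (i : ι) (j : l) :
    ‖(M * N) i j‖ ≤ c := by
  rw [Matrix.mul_apply]
  refine IsUltrametricDist.norm_sum_le_of_forall_le_of_nonneg hc fun t _ => ?_
  rw [norm_mul]
  exact (mul_le_of_le_one_left (norm_nonneg _) (PadicInt.norm_le_one _)).trans (h t j)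

/-- A quadratic matrix equation over `ℤ_p` that is contracting has a symmetric solution. -/
theorem exists_isSymm_eq_sub_smul_mul {ι : Type*} [Fintype ι] (h : ℤ_[p])
    {A E : Matrix ι ι ℤ_[p]} (hA : A.IsSymm) (hE : E.IsSymm) :
    ∃ F : Matrix ι ι ℤ_[p], F.IsSymm ∧ F = h • E - ((p : ℤ_[p]) * h) • (F * A * F) := by
  let _ : MetricSpace (Matrix ι ι ℤ_[p]) := inferInstanceAs (MetricSpace (ι → ι → ℤ_[p]))
  have : CompleteSpace (Matrix ι ι ℤ_[p]) := inferInstanceAs (CompleteSpace (ι → ι → ℤ_[p]))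
  let f : Matrix ι ι ℤ_[p] → Matrix ι ι ℤ_[p] := fun F =>
    h • E - ((p : ℤ_[p]) * h) • (F * A * F)
  -- In the entrywise sup metric, multiplication by an integral matrix does not increase norms, so
  -- the factor p in the quadratic term gives the contraction constant 1/p.
  have hf : ContractingWith (p : NNReal)⁻¹ f := by
    refine ⟨?_, LipschitzWith.of_dist_le_mul fun F G => ?_⟩
    · exact inv_lt_one_of_one_lt₀ (by exact_mod_cast (Fact.out : p.Prime).one_lt)
    · have h0 : (0 : ℝ) ≤ dist F G := dist_nonneg
      have hFG : ∀ i j, ‖(F - G) i j‖ ≤ dist F G := fun i j => by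
        rw [Matrix.sub_apply, ← dist_eq_norm]
        exact (dist_le_pi_dist (F i) (G i) j).trans
          (dist_le_pi_dist (X := fun _ => ι → ℤ_[p]) F G i)
      have key : ∀ i j, ‖(F * A * F - G * A * G) i j‖ ≤ dist F G := fun i j => by
        have e : F * A * F - G * A * G = (F - G) * (A * F) + G * A * (F - G) := by
          simp only [Matrix.sub_mul, Matrix.mul_sub, Matrix.mul_assoc]; abel
        rw [e, Matrix.add_apply]
        exact (IsUltrametricDist.norm_add_le_max _ _).trans
          (max_le (norm_matrix_mul_apply_le_left _ h0 hFG i j)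
            (norm_matrix_mul_apply_le_right _ h0 hFG i j))
      have h1 : (0 : ℝ) ≤ (p : ℝ)⁻¹ * dist F G := by positivity
      simp only [NNReal.coe_inv, NNReal.coe_natCast]
      refine (dist_pi_le_iff (X := fun _ => ι → ℤ_[p]) h1).2 fun i =>
        (dist_pi_le_iff h1).2 fun j => ?_
      have e : f F i j - f G i j = -(((p : ℤ_[p]) * h) * (F * A * F - G * A * G) i j) := by
        simp only [f, Matrix.sub_apply, Matrix.smul_apply, smul_eq_mul]; ring
      rw [dist_eq_norm, e, norm_neg, norm_mul, norm_mul, PadicInt.norm_p]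
      refine mul_le_mul ?_ (key i j) (norm_nonneg _) (by positivity)
      exact mul_le_of_le_one_right (by positivity) (PadicInt.norm_le_one _)
  have : Nonempty (Matrix ι ι ℤ_[p]) := ⟨0⟩
  have hfix := hf.fixedPoint_isFixedPt
  set F : Matrix ι ι ℤ_[p] := hf.fixedPoint with hF
  have e : F = h • E - ((p : ℤ_[p]) * h) • (F * A * F) := hfix.symm
  refine ⟨F, ?_, e⟩
  -- Symmetry comes from uniqueness: since A and E are symmetric, Fᵀ is a fixed point too.
  refine hf.fixedPoint_unique' (x := Fᵀ) (y := F) ?_ hfix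
  change h • E - ((p : ℤ_[p]) * h) • (Fᵀ * A * Fᵀ) = Fᵀ
  conv_rhs => rw [e]
  simp [hE.eq, hA.eq, Matrix.mul_assoc]

theorem isUnit_toZMod_iff {x : ℤ_[p]} : IsUnit (PadicInt.toZMod x) ↔ IsUnit x := by
  rw [isUnit_iff_ne_zero, Ne, ← RingHom.mem_ker, PadicInt.ker_toZMod,
    IsLocalRing.mem_maximalIdeal, mem_nonunits_iff, not_not]

theorem isUnit_det_map_iff {M : Matrix ι ι ℤ_[p]} :
    IsUnit (M.map PadicInt.toZMod).det ↔ IsUnit M.det := by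
  rw [← isUnit_toZMod_iff, RingHom.map_det]; rfl

theorem map_toZMod_add_smul {ι κ : Type*} (M N : Matrix ι κ ℤ_[p]) :
    (M + (p : ℤ_[p]) • N).map PadicInt.toZMod = M.map PadicInt.toZMod := by
  ext; simp

theorem isUnit_det_add_smul {M N : Matrix ι ι ℤ_[p]} :
    IsUnit (M + (p : ℤ_[p]) • N).det ↔ IsUnit M.det := by
  rw [← isUnit_det_map_iff, map_toZMod_add_smul, isUnit_det_map_iff]

theorem isUnit_two (hp : Odd p) : IsUnit (2 : ℤ_[p]) := by
  rw [← isUnit_toZMod_iff, map_ofNat, isUnit_iff_ne_zero]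
  intro h
  have : ((2 : ℕ) : ZMod p) = 0 := by exact_mod_cast h
  rw [ZMod.natCast_eq_zero_iff] at this
  have := (Nat.prime_dvd_prime_iff_eq Fact.out Nat.prime_two).1 this
  subst this
  exact absurd hp (by decide)

/-- With U = 1 + pAF and F symmetric, U A Uᵀ = A + pA(2F + pFAF)A. So it suffices to solve 2F + pFAF
= E, which is a contracting equation once 2 is inverted. The perturbation has the form AEA so that A
need not be invertible, as cancellation requires. -/
theorem isCongr_add_smul (hp : Odd p) {A E : Matrix ι ι ℤ_[p]} (hA : A.IsSymm) (hE : E.IsSymm) :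
    IsCongr A (A + (p : ℤ_[p]) • (A * E * A)) := by
  obtain ⟨h, hh⟩ := (isUnit_two (p := p) hp).exists_right_inv
  obtain ⟨F, hF, e⟩ := exists_isSymm_eq_sub_smul_mul h hA hE
  have hU : IsUnit (1 + (p : ℤ_[p]) • (A * F)).det := isUnit_det_add_smul.2 (by simp)
  convert IsCongr.of_isUnit_det (A := A) hU using 1
  have e2 : E = (2 : ℤ_[p]) • F + (p : ℤ_[p]) • (F * A * F) := by
    have : (2 : ℤ_[p]) • F = (2 * h) • E - ((p : ℤ_[p]) * (2 * h)) • (F * A * F) := by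
      conv_lhs => rw [e]
      rw [smul_sub, smul_smul, smul_smul]
      ring_nf
    rw [this, hh]
    simp
  simp only [transpose_add, transpose_one, transpose_smul, transpose_mul, hA.eq, hF.eq, e2]
  simp only [Matrix.mul_add, Matrix.add_mul, Matrix.mul_one, Matrix.one_mul, Matrix.smul_mul,
    Matrix.mul_smul, smul_add, Matrix.mul_assoc, two_smul]
  abel

theorem isCongr_of_eq_add_smul (hp : Odd p) {u a : Matrix ι ι ℤ_[p]} (hu : u.IsSymm)
    (hu' : IsUnit u.det) (ha : a.IsSymm) : IsCongr u (u + (p : ℤ_[p]) • a) := by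
  have hi : u⁻¹ᵀ = u⁻¹ := by rw [transpose_nonsing_inv, hu.eq]
  have hE : (u⁻¹ * a * u⁻¹).IsSymm := by
    simp [Matrix.IsSymm, hi, ha.eq, Matrix.mul_assoc]
  have := isCongr_add_smul hp hu hE
  rwa [show u * (u⁻¹ * a * u⁻¹) * u = a by
    simp [Matrix.mul_assoc, nonsing_inv_mul _ hu', mul_nonsing_inv_cancel_left _ _ hu']] at this

theorem smul_p_injective {ι κ : Type*} {M N : Matrix ι κ ℤ_[p]}
    (h : (p : ℤ_[p]) • M = (p : ℤ_[p]) • N) : M = N := by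
  ext i j
  have := congrFun (congrFun h i) j
  simp only [Matrix.smul_apply, smul_eq_mul] at this
  rw [mul_left_cancel₀ (by exact_mod_cast (Fact.out : p.Prime).ne_zero) this]

/-- Cancellation of a unimodular block against a complement divisible by `p`. -/
theorem IsCongr.cancel (hp : Odd p) {u : Matrix ι ι ℤ_[p]} (hu : u.IsSymm) (hu' : IsUnit u.det)
    {A S : Matrix κ κ ℤ_[p]} (hA : A.IsSymm)
    (h : IsCongr (Matrix.fromBlocks u 0 0 ((p : ℤ_[p]) • A))
      (Matrix.fromBlocks u 0 0 ((p : ℤ_[p]) • S))) : IsCongr A S := by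
  obtain ⟨V, hV⟩ := h
  have hVu : IsUnit (V : Matrix (ι ⊕ κ) (ι ⊕ κ) ℤ_[p]).det := (isUnit_iff_isUnit_det _).1 V.isUnit
  obtain ⟨v, w, x, y, hv⟩ : ∃ v w x y, (V : Matrix (ι ⊕ κ) (ι ⊕ κ) ℤ_[p]) =
    Matrix.fromBlocks v w x y := ⟨_, _, _, _, (fromBlocks_toBlocks _).symm⟩
  rw [hv] at hV hVu
  simp only [fromBlocks_transpose, fromBlocks_multiply, fromBlocks_inj, Matrix.mul_zero,
    add_zero, zero_add, Matrix.mul_smul, Matrix.smul_mul] at hV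
  obtain ⟨h11, h12, -, h22⟩ := hV
  -- The upper left block of the relation reads v u vᵀ ≡ u mod p.
  have hvu : IsUnit (v * u).det := by
    have : v * u * vᵀ = u + (p : ℤ_[p]) • (-(w * A * wᵀ)) := by
      rw [smul_neg, ← sub_eq_add_neg, eq_sub_iff_add_eq, ← h11]
    have h := (isUnit_det_add_smul (N := -(w * A * wᵀ))).2 hu'
    rw [← this, det_mul] at h
    exact isUnit_of_mul_isUnit_left h
  set z : Matrix κ ι ℤ_[p] := wᵀ * ((v * u)⁻¹)ᵀ with hz
  -- The upper right block of the relation, v u xᵀ + p w A yᵀ = 0, can be solved for x: it is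
  -- divisible by p and has y A as a left factor.
  have hx : x = -((p : ℤ_[p]) • (y * A * z)) := by
    have : xᵀ = -((p : ℤ_[p]) • ((v * u)⁻¹ * (w * A * yᵀ))) := by
      rw [← Matrix.mul_smul, ← Matrix.mul_neg, ← eq_neg_of_add_eq_zero_left h12.symm,
        nonsing_inv_mul_cancel_left _ _ hvu]
    rw [← transpose_transpose x, this]
    simp [hz, hA.eq, Matrix.mul_assoc]
  -- Modulo p the matrix V is block upper triangular, so its diagonal block y is invertible.
  have hy : IsUnit y.det := by
    have : Matrix.fromBlocks v w x y = Matrix.fromBlocks v w 0 y +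
        (p : ℤ_[p]) • Matrix.fromBlocks 0 0 (-(y * A * z)) 0 := by
      simp [fromBlocks_smul, fromBlocks_add, hx]
    rw [this, isUnit_det_add_smul, det_fromBlocks_zero₂₁] at hVu
    exact isUnit_of_mul_isUnit_right hVu
  -- Substituting x in the lower right block and dividing by p exhibits S as y-congruent to a
  -- perturbation of A of the form handled by `isCongr_add_smul`.
  have hS : S = y * (A + (p : ℤ_[p]) • (A * (z * u * zᵀ) * A)) * yᵀ := by
    apply smul_p_injective
    rw [h22, hx]
    simp [Matrix.mul_add, Matrix.add_mul, hA.eq, Matrix.mul_assoc, add_comm]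
  rw [hS]
  refine (isCongr_add_smul hp hA ?_).trans (IsCongr.of_isUnit_det hy)
  simp [Matrix.IsSymm, hu.eq, Matrix.mul_assoc]

/-- The Schur complement of u + pa in the right-hand matrix is p times the matrix compared with A.
The pivot u + pa is replaced by u through Hensel, and u is then cancelled. -/
theorem isCongr_fromBlocks_iff (hp : Odd p) {u a : Matrix ι ι ℤ_[p]} (hu : u.IsSymm)
    (hu' : IsUnit u.det) (ha : a.IsSymm) {A : Matrix κ κ ℤ_[p]} (hA : A.IsSymm)
    (b : Matrix ι κ ℤ_[p]) (c : Matrix κ κ ℤ_[p]) :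
    IsCongr (Matrix.fromBlocks u 0 0 ((p : ℤ_[p]) • A))
      (Matrix.fromBlocks u 0 0 0 + (p : ℤ_[p]) • Matrix.fromBlocks a b bᵀ c) ↔
    IsCongr A (c - (p : ℤ_[p]) • (bᵀ * (u + (p : ℤ_[p]) • a)⁻¹ * b)) := by
  set S := c - (p : ℤ_[p]) • (bᵀ * (u + (p : ℤ_[p]) • a)⁻¹ * b) with hS
  have h1 : IsCongr (Matrix.fromBlocks (u + (p : ℤ_[p]) • a) 0 0 ((p : ℤ_[p]) • S))
      (Matrix.fromBlocks u 0 0 0 + (p : ℤ_[p]) • Matrix.fromBlocks a b bᵀ c) := by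
    have := isCongr_schur (A := u + (p : ℤ_[p]) • a) (hu.add (ha.smul _))
      (isUnit_det_add_smul.2 hu') ((p : ℤ_[p]) • b) ((p : ℤ_[p]) • c)
    convert this using 2
    · simp [hS, smul_sub]
    · simp [fromBlocks_smul, fromBlocks_add]
  have h2 : IsCongr (Matrix.fromBlocks u 0 0 ((p : ℤ_[p]) • S)) _ :=
    ((isCongr_of_eq_add_smul hp hu hu' ha).fromBlocks (IsCongr.refl _)).trans h1
  refine ⟨fun h => IsCongr.cancel hp hu hu' hA (h.trans h2.symm), fun h => ?_⟩
  exact ((IsCongr.refl _).fromBlocks (h.smul _)).trans h2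

end Padic

/-! ### Haar measure on compact groups: uniqueness, push-forward, averaging over cosets -/

section CompactGroups

variable {G H : Type*} [AddCommGroup G] [TopologicalSpace G] [IsTopologicalAddGroup G]
  [MeasurableSpace G] [BorelSpace G]
  [AddCommGroup H] [TopologicalSpace H] [IsTopologicalAddGroup H]
  [CompactSpace H] [MeasurableSpace H] [BorelSpace H]

theorem eq_of_isAddLeftInvariant [CompactSpace G] (ν μ : Measure G)
    [μ.IsAddHaarMeasure] [IsProbabilityMeasure μ] [ν.IsAddLeftInvariant]
    [IsProbabilityMeasure ν] : ν = μ := by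
  have h := Measure.isAddInvariant_eq_smul_of_compactSpace ν μ
  have h1 := congrArg (fun m : Measure G => m Set.univ) h
  simp only [measure_univ, Measure.smul_apply, ENNReal.smul_def, smul_eq_mul, mul_one] at h1
  rw [h]
  have : Measure.addHaarScalarFactor ν μ = 1 := by exact_mod_cast h1.symm
  rw [this, one_smul]

theorem isAddLeftInvariant_of_preimage (ν : Measure G)
    (h : ∀ g S, MeasurableSet S → ν ((fun x => g + x) ⁻¹' S) = ν S) : ν.IsAddLeftInvariant :=
  ⟨fun g => Measure.ext fun S hS => by
    rw [Measure.map_apply (continuous_const_add g).measurable hS, h g S hS]⟩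

/-- A continuous map between compact groups that intertwines all translations of the target with
translations of the source preserves normalised Haar measures. -/
theorem measurePreserving_of_equivariant (μ : Measure G) (ν : Measure H) [μ.IsAddHaarMeasure]
    [IsProbabilityMeasure μ] [ν.IsAddHaarMeasure] [IsProbabilityMeasure ν] (f : G → H)
    (hf : Continuous f) (j : H → G) (hj : ∀ h g, f (j h + g) = h + f g) :
    MeasurePreserving f μ ν := by
  refine ⟨hf.measurable, ?_⟩
  have : IsProbabilityMeasure (μ.map f) := Measure.isProbabilityMeasure_map hf.aemeasurable
  have : (μ.map f).IsAddLeftInvariant := isAddLeftInvariant_of_preimage _ fun h S hS => by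
    rw [Measure.map_apply hf.measurable hS,
      Measure.map_apply hf.measurable ((continuous_const_add h).measurable hS),
      ← measure_preimage_add μ (j h) (f ⁻¹' S)]
    congr 1
    ext g
    simp [hj]
  exact eq_of_isAddLeftInvariant _ _

theorem measurePreserving_of_surjective (μ : Measure G) (ν : Measure H) [μ.IsAddHaarMeasure]
    [IsProbabilityMeasure μ] [ν.IsAddHaarMeasure] [IsProbabilityMeasure ν] (f : G →+ H)
    (hf : Continuous f) (hs : Function.Surjective f) : MeasurePreserving f μ ν :=
  measurePreserving_of_equivariant μ ν f hf (Function.surjInv hs) fun h g => by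
    rw [map_add, Function.surjInv_eq hs]

/-- Since x = x' + σ z for some z, the two sets are translates of each other by z. -/
theorem measure_preimage_add_hom_eq (μ : Measure G) [μ.IsAddHaarMeasure] {Q : Type*}
    [AddCommGroup Q] (f : G →+ Q) (σ : G →+ G)
    (hσ : ∀ x, f x = 0 ↔ ∃ y, σ y = x) (S : Set G) {x x' : G} (h : f x = f x') :
    μ {y | x + σ y ∈ S} = μ {y | x' + σ y ∈ S} := by
  obtain ⟨z, hz⟩ := (hσ (x - x')).1 (by rw [map_sub, h, sub_self])
  rw [← measure_preimage_add μ z {y | x' + σ y ∈ S}]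
  congr 1
  ext y
  simp [hz, ← add_assoc]

/-- Averaging the Haar measure over the cosets of a finite index subgroup that is the image of an
endomorphism. -/
theorem measure_eq_sum_fibres [CompactSpace G] (μ : Measure G) [μ.IsAddHaarMeasure]
    [IsProbabilityMeasure μ] {Q : Type*} [AddCommGroup Q] [Fintype Q] (f : G →+ Q)
    (hf : Function.Surjective f)
    (σ : G →+ G) (hσc : Continuous σ) (hσ : ∀ x, f x = 0 ↔ ∃ y, σ y = x)
    {S : Set G} (hS : MeasurableSet S) (T : Q → ENNReal)
    (hT : ∀ x, μ {y | x + σ y ∈ S} = T (f x)) :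
    μ S = (Fintype.card Q : ENNReal)⁻¹ * ∑ q, T q := by
  set s := Function.surjInv hf with hs
  have hfs : ∀ q, f (s q) = q := Function.surjInv_eq hf
  have hm : ∀ q, Measurable fun y => s q + σ y := fun q =>
    (continuous_const.add hσc).measurable
  let ν : Measure G := (Fintype.card Q : ENNReal)⁻¹ • ∑ q, μ.map fun y => s q + σ y
  have hν : ∀ S, MeasurableSet S →
      ν S = (Fintype.card Q : ENNReal)⁻¹ * ∑ q, μ {y | s q + σ y ∈ S} := fun S hS => by
    simp only [ν, Measure.smul_apply, Measure.finsetSum_apply, smul_eq_mul]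
    congr 1
    exact Finset.sum_congr rfl fun q _ => by rw [Measure.map_apply (hm q) hS]; rfl
  have : IsProbabilityMeasure ν := ⟨by
    rw [hν _ MeasurableSet.univ]
    simp [ENNReal.inv_mul_cancel]⟩
  -- Translation by g permutes the cosets through q ↦ f g + q, and the choice of representative in a
  -- coset does not affect its term. Uniqueness then identifies ν with μ.
  have : ν.IsAddLeftInvariant := isAddLeftInvariant_of_preimage _ fun g S hS => by
    rw [hν _ hS, hν _ ((continuous_const_add g).measurable hS)]
    congr 1
    rw [← Equiv.sum_comp (Equiv.addLeft (f g)) fun q => μ {y | s q + σ y ∈ S}]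
    refine Finset.sum_congr rfl fun q _ => ?_
    rw [measure_preimage_add_hom_eq μ f σ hσ S (x' := g + s q) (by simp [hfs])]
    simp [add_assoc]
  rw [← eq_of_isAddLeftInvariant ν μ, hν S hS]
  simp only [hT, hfs]

end CompactGroups

/-! ### The group of symmetric matrices and the congruence action -/

section SymMat

/-- The additive group of symmetric matrices. -/
def symMat (R ι : Type*) [AddCommGroup R] : AddSubgroup (Matrix ι ι R) where
  carrier := {A | A.IsSymm}
  zero_mem' := Matrix.isSymm_zero
  add_mem' := Matrix.IsSymm.add
  neg_mem' := Matrix.IsSymm.neg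

theorem mem_symMat {R ι : Type*} [AddCommGroup R] {A : Matrix ι ι R} :
    A ∈ symMat R ι ↔ A.IsSymm := Iff.rfl

/-- Symmetric matrices are functions on unordered pairs. -/
def symMatEquiv (R ι : Type*) [AddCommGroup R] : symMat R ι ≃ (Sym2 ι → R) where
  toFun A := Sym2.lift ⟨fun i j => A.1 i j, fun i j => (A.2.apply i j).symm⟩
  invFun x := ⟨of fun i j => x s(i, j), Matrix.IsSymm.ext fun i j => by simp [Sym2.eq_swap]⟩
  left_inv A := by ext; simp
  right_inv x := by
    ext z
    induction z with
    | _ i j => simp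

theorem card_symMat (R ι : Type*) [AddCommGroup R] [Fintype ι] :
    Nat.card (symMat R ι) = Nat.card R ^ (Fintype.card ι + 1).choose 2 := by
  classical
  rw [Nat.card_congr (symMatEquiv R ι), Nat.card_fun, Nat.card_eq_fintype_card (α := Sym2 ι),
    Sym2.card]

variable {R ι κ : Type*} [CommRing R] [Fintype ι] [DecidableEq ι]

/-- The action of an invertible matrix on symmetric matrices. -/
def congrHom (U : Matrix ι ι R) : symMat R ι →+ symMat R ι where
  toFun A := ⟨U * A.1 * Uᵀ, by simp [mem_symMat, Matrix.IsSymm, Matrix.mul_assoc, A.2.eq]⟩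
  map_zero' := by ext; simp
  map_add' A B := by ext; simp [Matrix.mul_add, Matrix.add_mul]

theorem congrHom_mul (U V : Matrix ι ι R) (A : symMat R ι) :
    congrHom (U * V) A = congrHom U (congrHom V A) := by
  ext1; simp [congrHom, Matrix.mul_assoc]

theorem congrHom_one (A : symMat R ι) : congrHom 1 A = A := by
  ext1; simp [congrHom]

instance : MulAction (GL ι R) (symMat R ι) where
  smul U A := congrHom (U : Matrix ι ι R) A
  one_smul A := congrHom_one A
  mul_smul _ _ A := congrHom_mul _ _ A

theorem coe_smul_symMat (U : GL ι R) (A : symMat R ι) :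
    ((U • A : symMat R ι) : Matrix ι ι R) = U * A * (U : Matrix ι ι R)ᵀ := rfl

theorem mem_orbit_iff_isCongr {A B : symMat R ι} :
    B ∈ MulAction.orbit (GL ι R) A ↔ IsCongr (A : Matrix ι ι R) B := by
  simp only [MulAction.mem_orbit_iff, IsCongr, ← Subtype.coe_inj, coe_smul_symMat, eq_comm]

end SymMat

/-! ### Haar measure and reduction modulo p on symmetric p-adic matrices -/

section PadicSymMat

variable {p : ℕ} [Fact p.Prime] {ι κ : Type*} [Fintype ι] [DecidableEq ι]
  [Fintype κ] [DecidableEq κ]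

instance {ι : Type*} [Fintype ι] : CompactSpace (symMat ℤ_[p] ι) := by
  have : CompactSpace (Matrix ι ι ℤ_[p]) := inferInstanceAs (CompactSpace (ι → ι → ℤ_[p]))
  refine isCompact_iff_compactSpace.1 (IsClosed.isCompact ?_)
  exact isClosed_eq continuous_id.matrix_transpose continuous_id

instance {ι : Type*} : MeasurableSpace (symMat ℤ_[p] ι) := borel _

instance {ι : Type*} : BorelSpace (symMat ℤ_[p] ι) := ⟨rfl⟩

/-- The normalised Haar measure on symmetric matrices over `ℤ_p`. -/
def symHaar (p : ℕ) [Fact p.Prime] (ι : Type*) [Fintype ι] :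
    Measure (symMat ℤ_[p] ι) :=
  Measure.addHaarMeasure ⊤

instance {ι : Type*} [Fintype ι] : (symHaar p ι).IsAddHaarMeasure := by unfold symHaar; infer_instance

instance {ι : Type*} [Fintype ι] : IsProbabilityMeasure (symHaar p ι) :=
  ⟨by simpa [symHaar] using
    Measure.addHaarMeasure_self (K₀ := (⊤ : TopologicalSpace.PositiveCompacts (symMat ℤ_[p] ι)))⟩

/-- The set of symmetric matrices congruent to `A`. -/
def congrClass (A : Matrix ι ι ℤ_[p]) : Set (symMat ℤ_[p] ι) := {X | IsCongr A X}

theorem continuous_congrHom (U : Matrix ι ι ℤ_[p]) : Continuous (congrHom U) :=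
  Continuous.subtype_mk ((continuous_const.matrix_mul continuous_subtype_val).matrix_mul
    continuous_const) _

theorem measurePreserving_congrHom (U : GL ι ℤ_[p]) :
    MeasurePreserving (congrHom (U : Matrix ι ι ℤ_[p])) (symHaar p ι) (symHaar p ι) :=
  measurePreserving_of_surjective _ _ _ (continuous_congrHom _) (MulAction.surjective U)

/-- The class is the continuous image of the invertible matrices, which form the closed subset |det|
= 1 of a compact space; hence it is closed. -/
theorem measurableSet_congrClass {A : Matrix ι ι ℤ_[p]} (hA : A.IsSymm) :
    MeasurableSet (congrClass A) := by
  have : CompactSpace (Matrix ι ι ℤ_[p]) := inferInstanceAs (CompactSpace (ι → ι → ℤ_[p]))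
  have hK : IsCompact {U : Matrix ι ι ℤ_[p] | IsUnit U.det} := by
    simp only [PadicInt.isUnit_iff]
    exact (isClosed_eq (continuous_id.matrix_det).norm continuous_const).isCompact
  have hc : Continuous fun U : Matrix ι ι ℤ_[p] => congrHom U ⟨A, hA⟩ :=
    Continuous.subtype_mk ((continuous_id.matrix_mul continuous_const).matrix_mul
      continuous_id.matrix_transpose) _
  have he : congrClass A = (fun U : Matrix ι ι ℤ_[p] => congrHom U ⟨A, hA⟩) ''
      {U : Matrix ι ι ℤ_[p] | IsUnit U.det} := by
    ext X
    constructor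
    · rintro ⟨U, hU⟩
      exact ⟨U, (isUnit_iff_isUnit_det _).1 U.isUnit, Subtype.ext hU.symm⟩
    · rintro ⟨U, hU, rfl⟩
      exact IsCongr.of_isUnit_det hU
  rw [he]
  exact (hK.image hc).isClosed.measurableSet

/-- Reindexing of symmetric matrices. -/
def symReindex (e : κ ≃ ι) : symMat ℤ_[p] ι →+ symMat ℤ_[p] κ where
  toFun A := ⟨A.1.submatrix e e, by simp [mem_symMat, Matrix.IsSymm, A.2.eq]⟩
  map_zero' := by ext; simp
  map_add' A B := by ext; simp

theorem symHaar_congrClass_submatrix (e : κ ≃ ι) {A : Matrix ι ι ℤ_[p]} (hA : A.IsSymm) :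
    symHaar p κ (congrClass (A.submatrix e e)) = symHaar p ι (congrClass A) := by
  have hA' : (A.submatrix e e).IsSymm := by simp [Matrix.IsSymm, hA.eq]
  have h : MeasurePreserving (symReindex (p := p) e) (symHaar p ι) (symHaar p κ) := by
    refine measurePreserving_of_surjective _ _ _ ?_ fun B => ?_
    · exact Continuous.subtype_mk (continuous_subtype_val.matrix_submatrix e e) _
    · exact ⟨symReindex e.symm B, by ext; simp [symReindex]⟩
  rw [← h.measure_preimage (measurableSet_congrClass hA').nullMeasurableSet]
  congr 1
  ext X
  exact isCongr_submatrix_iff e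

/-- Reduction modulo `p` of symmetric matrices. -/
def symRed (p : ℕ) [Fact p.Prime] (ι : Type*) : symMat ℤ_[p] ι →+ symMat (ZMod p) ι where
  toFun A := ⟨A.1.map PadicInt.toZMod, by
    rw [mem_symMat, Matrix.IsSymm, ← transpose_map, A.2.eq]⟩
  map_zero' := by ext; simp
  map_add' A B := by ext; simp

theorem toZMod_surjective : Function.Surjective (PadicInt.toZMod : ℤ_[p] →+* ZMod p) :=
  ZMod.ringHom_surjective _

theorem exists_map_toZMod_eq {ι κ : Type*} (A : Matrix ι κ (ZMod p)) :
    ∃ B : Matrix ι κ ℤ_[p], B.map PadicInt.toZMod = A :=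
  ⟨A.map (Function.surjInv toZMod_surjective), by
    ext; simp [Function.surjInv_eq toZMod_surjective]⟩

theorem symRed_surjective {ι : Type*} : Function.Surjective (symRed p ι) := fun A => by
  refine ⟨⟨A.1.map (Function.surjInv toZMod_surjective), ?_⟩, ?_⟩
  · rw [mem_symMat, Matrix.IsSymm, ← transpose_map, A.2.eq]
  · ext; simp [symRed]

/-- Any entrywise lift works, since a p-adic determinant is a unit as soon as its residue is. -/
theorem exists_glMap_eq (U : GL ι (ZMod p)) :
    ∃ V : GL ι ℤ_[p], (V : Matrix ι ι ℤ_[p]).map PadicInt.toZMod = U := by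
  obtain ⟨V, hV⟩ := exists_map_toZMod_eq (U : Matrix ι ι (ZMod p))
  have : IsUnit V.det := by
    rw [← isUnit_det_map_iff, hV]
    exact (isUnit_iff_isUnit_det _).1 U.isUnit
  exact ⟨GeneralLinearGroup.mk'' V this, hV⟩

theorem toZMod_eq_zero_iff {x : ℤ_[p]} : PadicInt.toZMod x = 0 ↔ ∃ y, (p : ℤ_[p]) * y = x := by
  rw [← RingHom.mem_ker, PadicInt.ker_toZMod, PadicInt.maximalIdeal_eq_span_p,
    Ideal.mem_span_singleton]
  exact ⟨fun ⟨y, h⟩ => ⟨y, h.symm⟩, fun ⟨y, h⟩ => ⟨y, h.symm⟩⟩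

/-- Multiplication by `p` on symmetric matrices. -/
def symMulP (p : ℕ) [Fact p.Prime] (ι : Type*) : symMat ℤ_[p] ι →+ symMat ℤ_[p] ι where
  toFun A := ⟨(p : ℤ_[p]) • A.1, A.2.smul _⟩
  map_zero' := by ext; simp
  map_add' A B := by ext; simp [mul_add]

theorem continuous_symMulP {ι : Type*} : Continuous (symMulP p ι) :=
  Continuous.subtype_mk (continuous_subtype_val.const_smul (p : ℤ_[p])) _

theorem symRed_eq_zero_iff {ι : Type*} (A : symMat ℤ_[p] ι) :
    symRed p ι A = 0 ↔ ∃ B, symMulP p ι B = A := by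
  constructor
  · intro h
    have h' : ∀ i j, ∃ y, (p : ℤ_[p]) * y = A.1 i j := fun i j =>
      toZMod_eq_zero_iff.1 (congrFun (congrFun (congrArg Subtype.val h) i) j)
    choose y hy using h'
    have e : (p : ℤ_[p]) • (of y) = A.1 := by ext i j; exact hy i j
    refine ⟨⟨of y, ?_⟩, Subtype.ext e⟩
    apply smul_p_injective
    rw [← transpose_smul, e, A.2.eq]
  · rintro ⟨B, rfl⟩
    ext i j
    simp [symRed, symMulP]

end PadicSymMat

/-! ### The stabiliser of a degenerate form over a field -/

section Stabilizer

variable {F α β : Type*} [Field F] [Fintype α] [DecidableEq α] [Fintype β] [DecidableEq β]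

/-- The symmetric block matrix with diagonal blocks `A` and `B`. -/
def symBlock {R : Type*} [CommRing R] (A : symMat R α) (B : symMat R β) : symMat R (α ⊕ β) :=
  ⟨fromBlocks A 0 0 B, by
    rw [mem_symMat, Matrix.IsSymm, fromBlocks_transpose, A.2.eq, B.2.eq]; simp⟩

theorem mem_stabilizer_iff {ι : Type*} [Fintype ι] [DecidableEq ι] {A : symMat F ι} {g : GL ι F} :
    g ∈ MulAction.stabilizer (GL ι F) A ↔ (g : Matrix ι ι F) * A * (g : Matrix ι ι F)ᵀ = A := by
  rw [MulAction.mem_stabilizer_iff, ← Subtype.coe_inj, coe_smul_symMat]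

/-- An invertible block upper triangular matrix. -/
def glUpper (a : GL α F) (d : GL β F) (b : Matrix α β F) : GL (α ⊕ β) F :=
  GeneralLinearGroup.mk'' (fromBlocks a b 0 d) (by
    rw [det_fromBlocks_zero₂₁]
    exact ((isUnit_iff_isUnit_det _).1 a.isUnit).mul ((isUnit_iff_isUnit_det _).1 d.isUnit))

theorem coe_glUpper (a : GL α F) (d : GL β F) (b : Matrix α β F) :
    (glUpper a d b : Matrix (α ⊕ β) (α ⊕ β) F) = fromBlocks (a : Matrix α α F) b 0 d := rfl

theorem glUpper_mem_stabilizer {u : symMat F α} {a : GL α F}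
    (ha : a ∈ MulAction.stabilizer (GL α F) u) (d : GL β F) (b : Matrix α β F) :
    glUpper a d b ∈ MulAction.stabilizer (GL (α ⊕ β) F) (symBlock u (0 : symMat F β)) := by
  rw [mem_stabilizer_iff] at ha ⊢
  rw [coe_glUpper]
  simp [symBlock, fromBlocks_transpose, fromBlocks_multiply, ha]

/-- For g with blocks a, b, c, d, fixing diag(u, 0) means a u aᵀ = u and c u aᵀ = 0 (with the
transposed equation and c u cᵀ = 0). The first makes u aᵀ invertible, so c = 0, while b is
unconstrained and d only has to be invertible. -/
theorem exists_glUpper_of_mem_stabilizer {u : symMat F α} (hu : IsUnit (u : Matrix α α F).det)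
    {g : GL (α ⊕ β) F}
    (hg : g ∈ MulAction.stabilizer (GL (α ⊕ β) F) (symBlock u (0 : symMat F β))) :
    ∃ a ∈ MulAction.stabilizer (GL α F) u, ∃ d b, glUpper a d b = g := by
  rw [mem_stabilizer_iff] at hg
  have hgu : IsUnit (g : Matrix (α ⊕ β) (α ⊕ β) F).det := (isUnit_iff_isUnit_det _).1 g.isUnit
  obtain ⟨a, b, c, d, hv⟩ : ∃ a b c d, (g : Matrix (α ⊕ β) (α ⊕ β) F) =
    fromBlocks a b c d := ⟨_, _, _, _, (fromBlocks_toBlocks _).symm⟩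
  rw [hv] at hg hgu
  simp only [symBlock, fromBlocks_transpose, fromBlocks_multiply, fromBlocks_inj, Matrix.mul_zero,
    Matrix.zero_mul, add_zero, ZeroMemClass.coe_zero] at hg
  obtain ⟨h11, h12, h21, -⟩ := hg
  have ha : IsUnit (u * aᵀ : Matrix α α F).det := by
    rw [← h11, Matrix.mul_assoc, det_mul] at hu
    exact isUnit_of_mul_isUnit_right hu
  have hc : c = 0 := by
    rw [Matrix.mul_assoc] at h21
    rw [← mul_nonsing_inv_cancel_right _ c ha, h21, Matrix.zero_mul]
  subst hc
  have ha' : IsUnit a.det := by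
    rw [det_mul, det_transpose] at ha
    exact isUnit_of_mul_isUnit_right ha
  rw [det_fromBlocks_zero₂₁] at hgu
  refine ⟨GeneralLinearGroup.mk'' a ha', mem_stabilizer_iff.2 h11,
    GeneralLinearGroup.mk'' d (isUnit_of_mul_isUnit_right hgu), b, ?_⟩
  exact Units.ext hv.symm

theorem card_stabilizer_symBlock {u : symMat F α} (hu : IsUnit (u : Matrix α α F).det) :
    Nat.card (MulAction.stabilizer (GL (α ⊕ β) F) (symBlock u (0 : symMat F β))) =
      Nat.card (MulAction.stabilizer (GL α F) u) * Nat.card (GL β F) *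
        Nat.card F ^ (Fintype.card α * Fintype.card β) := by
  let f : (MulAction.stabilizer (GL α F) u × GL β F) × Matrix α β F →
      MulAction.stabilizer (GL (α ⊕ β) F) (symBlock u (0 : symMat F β)) := fun x =>
    ⟨glUpper x.1.1 x.1.2 x.2, glUpper_mem_stabilizer x.1.1.2 _ _⟩
  have hf : Function.Bijective f := by
    constructor
    · rintro ⟨⟨⟨a, ha⟩, d⟩, b⟩ ⟨⟨⟨a', ha'⟩, d'⟩, b'⟩ h
      have h' : fromBlocks (a : Matrix α α F) b 0 (d : Matrix β β F) =
          fromBlocks (a' : Matrix α α F) b' 0 (d' : Matrix β β F) :=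
        congrArg (fun g => (g.1 : Matrix (α ⊕ β) (α ⊕ β) F)) h
      obtain ⟨h1, h2, -, h3⟩ := fromBlocks_inj.1 h'
      obtain rfl := Units.ext h1
      obtain rfl := Units.ext h3
      obtain rfl := h2
      rfl
    · rintro ⟨g, hg⟩
      obtain ⟨a, ha, d, b, rfl⟩ := exists_glUpper_of_mem_stabilizer hu hg
      exact ⟨((⟨a, ha⟩, d), b), rfl⟩
  rw [← Nat.card_congr (Equiv.ofBijective f hf), Nat.card_prod, Nat.card_prod]
  congr 1
  change Nat.card (α → β → F) = _
  rw [Nat.card_fun, Nat.card_fun, ← pow_mul, mul_comm]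
  simp

end Stabilizer

/-! ### One step of the recursion -/

section Step

variable {p : ℕ} [Fact p.Prime] {α β : Type*} [Fintype α] [DecidableEq α]
  [Fintype β] [DecidableEq β]

theorem continuous_nonsing_inv {T ι : Type*} [TopologicalSpace T] [Fintype ι] [DecidableEq ι]
    {f : T → Matrix ι ι ℤ_[p]} (hf : Continuous f) (h : ∀ t, IsUnit (f t).det) :
    Continuous fun t => (f t)⁻¹ := by
  refine continuous_iff_continuousAt.2 fun t => ?_
  obtain ⟨v, hv⟩ := h t
  have hi := NormedRing.inverse_continuousAt v
  rw [hv] at hi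
  exact ContinuousAt.comp (continuousAt_matrix_inv _ hi) hf.continuousAt

/-- The Schur complement of `u + p a` in `diag(u, 0) + p Y`, divided by `p`, where `a` is the first
diagonal block of `Y`. -/
def schurMap (u : symMat ℤ_[p] α) (Y : symMat ℤ_[p] (α ⊕ β)) : symMat ℤ_[p] β :=
  ⟨Y.1.toBlocks₂₂ - (p : ℤ_[p]) • (Y.1.toBlocks₁₂ᵀ * (u.1 + (p : ℤ_[p]) • Y.1.toBlocks₁₁)⁻¹ *
    Y.1.toBlocks₁₂), by
    have h := fromBlocks_toBlocks Y.1
    have h' : (Y.1)ᵀ = Y.1 := Y.2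
    rw [← h, fromBlocks_transpose, fromBlocks_inj] at h'
    simp [mem_symMat, Matrix.IsSymm, transpose_nonsing_inv, u.2.eq, h'.1, h'.2.2.2,
      Matrix.mul_assoc]⟩

/-- The map is not additive, but adding h to the lower right block of Y adds h to the value. This
equivariance already forces the push-forward to be translation invariant. -/
theorem measurePreserving_schurMap {β : Type*} [Fintype β] {u : symMat ℤ_[p] α}
    (hu : IsUnit (u : Matrix α α ℤ_[p]).det) :
    MeasurePreserving (schurMap (β := β) u) (symHaar p (α ⊕ β)) (symHaar p β) := by
  refine measurePreserving_of_equivariant _ _ _ ?_ (fun h => symBlock 0 h) fun h Y => ?_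
  · have h1 : Continuous fun Y : symMat ℤ_[p] (α ⊕ β) => Y.1.toBlocks₁₁ :=
      continuous_subtype_val.matrix_submatrix _ _
    have h2 : Continuous fun Y : symMat ℤ_[p] (α ⊕ β) => Y.1.toBlocks₁₂ :=
      continuous_subtype_val.matrix_submatrix _ _
    have h3 : Continuous fun Y : symMat ℤ_[p] (α ⊕ β) => Y.1.toBlocks₂₂ :=
      continuous_subtype_val.matrix_submatrix _ _
    have h4 : Continuous fun Y : symMat ℤ_[p] (α ⊕ β) =>
        (u.1 + (p : ℤ_[p]) • Y.1.toBlocks₁₁)⁻¹ :=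
      continuous_nonsing_inv (continuous_const.add (h1.const_smul (p : ℤ_[p])))
        fun Y => isUnit_det_add_smul.2 hu
    refine Continuous.subtype_mk (h3.sub (Continuous.const_smul ?_ (p : ℤ_[p]))) _
    exact (h2.matrix_transpose.matrix_mul h4).matrix_mul h2
  · apply Subtype.ext
    have e1 : (symBlock 0 h + Y).1.toBlocks₁₁ = Y.1.toBlocks₁₁ := by
      ext; simp [symBlock, toBlocks₁₁]
    have e2 : (symBlock 0 h + Y).1.toBlocks₁₂ = Y.1.toBlocks₁₂ := by
      ext; simp [symBlock, toBlocks₁₂]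
    have e3 : (symBlock 0 h + Y).1.toBlocks₂₂ = h.1 + Y.1.toBlocks₂₂ := by
      ext; simp [symBlock, toBlocks₂₂]
    rw [AddSubgroup.coe_add]
    unfold schurMap
    simp only [e1, e2, e3, add_sub_assoc]

theorem mem_congrClass_iff_schurMap (hp : Odd p) {u : symMat ℤ_[p] α}
    (hu : IsUnit (u : Matrix α α ℤ_[p]).det) (A : symMat ℤ_[p] β) (Y : symMat ℤ_[p] (α ⊕ β)) :
    symBlock u 0 + symMulP p _ Y ∈ congrClass (p := p) (symBlock u (symMulP p _ A)).1 ↔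
      schurMap u Y ∈ congrClass A.1 := by
  have h := fromBlocks_toBlocks Y.1
  have h' : (Y.1)ᵀ = Y.1 := Y.2
  rw [← h, fromBlocks_transpose, fromBlocks_inj] at h'
  have key := isCongr_fromBlocks_iff hp u.2 hu h'.1 A.2 Y.1.toBlocks₁₂ Y.1.toBlocks₂₂
  have hY : fromBlocks Y.1.toBlocks₁₁ Y.1.toBlocks₁₂ Y.1.toBlocks₁₂ᵀ Y.1.toBlocks₂₂ = Y.1 := by
    rw [h'.2.2.1, h]
  rw [hY] at key
  exact key

theorem symRed_congrHom (U : Matrix α α ℤ_[p]) (A : symMat ℤ_[p] α) :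
    symRed p α (congrHom U A) = congrHom (U.map PadicInt.toZMod) (symRed p α A) := by
  ext1
  simp [symRed, congrHom, Matrix.map_mul, transpose_map]

theorem symRed_symBlock_smul {α β : Type*} (u : symMat ℤ_[p] α) (A : symMat ℤ_[p] β) :
    symRed p _ (symBlock u (symMulP p _ A)) = symBlock (symRed p _ u) 0 := by
  ext i j
  cases i <;> cases j <;> simp [symRed, symBlock, symMulP]

theorem symRed_symBlock_zero {α β : Type*} (u : symMat ℤ_[p] α) :
    symRed p _ (symBlock u (0 : symMat ℤ_[p] β)) = symBlock (symRed p _ u) 0 := by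
  rw [← symRed_symBlock_smul u 0, map_zero]

theorem symRed_mem_orbit {A X : symMat ℤ_[p] α} (h : X ∈ congrClass A.1) :
    symRed p α X ∈ MulAction.orbit (GL α (ZMod p)) (symRed p α A) :=
  mem_orbit_iff_isCongr.2 (IsCongr.map PadicInt.toZMod h)

/-- Each residue in the orbit gives the same conditional measure. One replaces x by U diag(u, 0) Uᵀ,
where U lifts the matrix realising the residue, and substitutes U y Uᵀ for y, which preserves Haar
measure. As the class is stable under congruence, U disappears and the Schur complement takes over.
-/
theorem symHaar_fibre_eq (hp : Odd p) {u : symMat ℤ_[p] α}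
    (hu : IsUnit (u : Matrix α α ℤ_[p]).det) (A : symMat ℤ_[p] β) {x : symMat ℤ_[p] (α ⊕ β)}
    (hx : symRed p _ x ∈
      MulAction.orbit (GL (α ⊕ β) (ZMod p)) (symBlock (symRed p _ u) (0 : symMat (ZMod p) β))) :
    symHaar p (α ⊕ β) {y | x + symMulP p _ y ∈ congrClass (symBlock u (symMulP p _ A)).1} =
      symHaar p β (congrClass A.1) := by
  obtain ⟨V, hV⟩ := hx
  obtain ⟨U, hU⟩ := exists_glMap_eq V
  set D : symMat ℤ_[p] (α ⊕ β) := symBlock u 0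
  set S := congrClass (symBlock u (symMulP p _ A)).1
  have hS : MeasurableSet S := measurableSet_congrClass (symBlock u (symMulP p _ A)).2
  have hx' : symRed p _ x = symRed p _ (congrHom (U : Matrix _ _ ℤ_[p]) D) := by
    rw [symRed_congrHom, hU, symRed_symBlock_zero]
    exact hV.symm
  have hm : Measurable fun y => congrHom (U : Matrix _ _ ℤ_[p]) D + symMulP p _ y :=
    (continuous_const.add continuous_symMulP).measurable
  rw [measure_preimage_add_hom_eq _ (symRed p _) (symMulP p _) symRed_eq_zero_iff S hx']
  change symHaar p (α ⊕ β)
    ((fun y => congrHom (U : Matrix _ _ ℤ_[p]) D + symMulP p _ y) ⁻¹' S) = _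
  rw [← (measurePreserving_congrHom U).measure_preimage
      (hm hS).nullMeasurableSet,
    ← (measurePreserving_schurMap (β := β) hu).measure_preimage
      (measurableSet_congrClass A.2).nullMeasurableSet]
  congr 1
  ext y
  have e : congrHom (U : Matrix _ _ ℤ_[p]) D + symMulP p _ (congrHom (U : Matrix _ _ ℤ_[p]) y) =
      congrHom (U : Matrix _ _ ℤ_[p]) (D + symMulP p _ y) := by
    rw [map_add]; congr 1; ext1; simp [symMulP, congrHom]
  have hy := mem_congrClass_iff_schurMap hp hu A y
  change congrHom (U : Matrix _ _ ℤ_[p]) D + symMulP p _ (congrHom (U : Matrix _ _ ℤ_[p]) y) ∈ S ↔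
    schurMap u y ∈ congrClass A.1
  rw [← hy, e]
  have hc : IsCongr (D + symMulP p _ y).1 (congrHom (U : Matrix _ _ ℤ_[p]) (D + symMulP p _ y)).1 :=
    ⟨U, rfl⟩
  exact ⟨fun h => IsCongr.trans h hc.symm, fun h => IsCongr.trans h hc⟩

/-- The measure is the average of the conditional measures over all residues: the proportion of
residues in the orbit of diag(ū, 0), times the measure of the class of A. The two quotients give the
orbit size, by orbit–stabiliser, and then divide by the number of symmetric matrices over 𝔽_p. -/
theorem symHaar_congrClass_symBlock (hp : Odd p) {u : symMat ℤ_[p] α}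
    (hu : IsUnit (u : Matrix α α ℤ_[p]).det) (A : symMat ℤ_[p] β) :
    (symHaar p (α ⊕ β)).real (congrClass (symBlock u (symMulP p _ A)).1) =
      Nat.card (GL (α ⊕ β) (ZMod p)) /
        (Nat.card (MulAction.stabilizer (GL α (ZMod p)) (symRed p _ u)) *
          Nat.card (GL β (ZMod p)) * (p : ℝ) ^ (Fintype.card α * Fintype.card β)) /
        (p : ℝ) ^ (Fintype.card α + Fintype.card β + 1).choose 2 *
        (symHaar p β).real (congrClass A.1) := by
  classical
  set D : symMat (ZMod p) (α ⊕ β) := symBlock (symRed p _ u) 0 with hD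
  let _ : Fintype (symMat (ZMod p) (α ⊕ β)) := Fintype.ofFinite _
  have hsum := measure_eq_sum_fibres (symHaar p (α ⊕ β)) (symRed p _) symRed_surjective
    (symMulP p _) continuous_symMulP symRed_eq_zero_iff
    (measurableSet_congrClass (symBlock u (symMulP p _ A)).2)
    (fun q => if q ∈ MulAction.orbit (GL (α ⊕ β) (ZMod p)) D then
      symHaar p β (congrClass A.1) else 0) (fun x => by
        split_ifs with hx
        · exact symHaar_fibre_eq hp hu A hx
        -- A residue outside the orbit contributes nothing: congruent matrices have congruent
        -- reductions.
        · rw [← measure_empty (μ := symHaar p (α ⊕ β))]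
          congr 1
          refine Set.eq_empty_iff_forall_notMem.2 fun y hy => hx ?_
          have h := symRed_mem_orbit hy
          rwa [symRed_symBlock_smul, map_add, (symRed_eq_zero_iff _).2 ⟨y, rfl⟩, add_zero] at h)
  have hred : IsUnit (symRed p _ u : Matrix α α (ZMod p)).det := isUnit_det_map_iff.2 hu
  have hst : (Nat.card (MulAction.orbit (GL (α ⊕ β) (ZMod p)) D) : ℝ) *
      (Nat.card (MulAction.stabilizer (GL α (ZMod p)) (symRed p _ u)) *
          Nat.card (GL β (ZMod p)) * (p : ℝ) ^ (Fintype.card α * Fintype.card β)) =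
      Nat.card (GL (α ⊕ β) (ZMod p)) := by
    have h := card_stabilizer_symBlock (β := β) hred
    rw [Nat.card_zmod] at h
    have h' := Nat.card_congr (MulAction.orbitProdStabilizerEquivGroup (GL (α ⊕ β) (ZMod p)) D)
    rw [Nat.card_prod, h] at h'
    exact_mod_cast h'
  have hp0 : (p : ℝ) ≠ 0 := by exact_mod_cast (Fact.out : p.Prime).ne_zero
  have hcs : Fintype.card (symMat (ZMod p) (α ⊕ β)) =
      p ^ (Fintype.card α + Fintype.card β + 1).choose 2 := by
    rw [← Nat.card_eq_fintype_card, card_symMat, Nat.card_zmod, Fintype.card_sum]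
  have hne : (Nat.card (MulAction.stabilizer (GL α (ZMod p)) (symRed p _ u)) : ℝ) *
          Nat.card (GL β (ZMod p)) * (p : ℝ) ^ (Fintype.card α * Fintype.card β) ≠ 0 := by
    refine mul_ne_zero (mul_ne_zero ?_ ?_) (pow_ne_zero _ hp0)
    · exact_mod_cast Nat.card_pos.ne'
    · exact_mod_cast Nat.card_pos.ne'
  have hT : ∑ q, (if q ∈ MulAction.orbit (GL (α ⊕ β) (ZMod p)) D then
      symHaar p β (congrClass A.1) else 0) =
      (Nat.card (MulAction.orbit (GL (α ⊕ β) (ZMod p)) D) : ENNReal) *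
        symHaar p β (congrClass A.1) := by
    rw [Finset.sum_ite, Finset.sum_const, Finset.sum_const_zero, add_zero, nsmul_eq_mul,
      ← Fintype.card_subtype, ← Nat.card_eq_fintype_card]
  rw [hT] at hsum
  rw [Measure.real, hsum, ← hst, mul_div_cancel_right₀ _ hne, hcs]
  simp only [ENNReal.toReal_mul, ENNReal.toReal_inv, ENNReal.toReal_natCast]
  push_cast
  rw [div_eq_inv_mul, mul_assoc]
  rfl

end Step

/-! ### The law of the random symmetric matrix -/

section Law

variable {p : ℕ} [Fact p.Prime] {n : ℕ}

/-- The symmetric matrix with prescribed entries on and above the diagonal. -/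
def symOfUpper (p : ℕ) [Fact p.Prime] (n : ℕ) :
    ({e : Fin n × Fin n // e.1 ≤ e.2} → ℤ_[p]) →+ symMat ℤ_[p] (Fin n) where
  toFun x := ⟨of fun i j => x ⟨(min i j, max i j), min_le_max⟩, Matrix.IsSymm.ext fun i j => by
    simp only [of_apply, min_comm, max_comm]⟩
  map_zero' := by ext; simp
  map_add' x y := by ext; simp

theorem symOfUpper_entries {A : Matrix (Fin n) (Fin n) ℤ_[p]} (hA : A.IsSymm) :
    (symOfUpper p n fun e => A e.1.1 e.1.2).1 = A := by
  ext i j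
  rcases le_total i j with h | h
  · simp [symOfUpper, h]
  · simp [symOfUpper, h, hA.apply i j]

theorem continuous_symOfUpper : Continuous (symOfUpper p n) :=
  Continuous.subtype_mk (continuous_matrix fun i j => continuous_apply
    (⟨(min i j, max i j), min_le_max⟩ : {e : Fin n × Fin n // e.1 ≤ e.2})) _

theorem symOfUpper_surjective : Function.Surjective (symOfUpper p n) := fun A =>
  ⟨_, Subtype.ext (symOfUpper_entries A.2)⟩

instance : (haar p).IsAddHaarMeasure := by unfold haar; infer_instance

theorem measurePreserving_symOfUpper :
    MeasurePreserving (symOfUpper p n) (Measure.pi fun _ => haar p) (symHaar p (Fin n)) :=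
  measurePreserving_of_surjective _ _ _ continuous_symOfUpper symOfUpper_surjective

/-- Independence makes the joint law of the entries on and above the diagonal a product of Haar
measures. Filling in the matrix is a continuous surjective homomorphism, so it carries this law to
Haar measure on symmetric matrices. -/
theorem IsHaarSymmetric.real_congrOrbit {Ω : Type*} [MeasurableSpace Ω] {P : Measure Ω}
    [IsProbabilityMeasure P] {X : Ω → Matrix (Fin n) (Fin n) ℤ_[p]} (hX : IsHaarSymmetric X P)
    {A : Matrix (Fin n) (Fin n) ℤ_[p]} (hA : A.IsSymm) :
    P.real {ω | X ω ∈ congrOrbit A} = (symHaar p (Fin n)).real (congrClass A) := by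
  have hm : ∀ e : {e : Fin n × Fin n // e.1 ≤ e.2},
      AEMeasurable (fun ω => X ω e.1.1 e.1.2) P := fun e => (hX.law _ _ e.2).aemeasurable
  have hlaw := (iIndepFun_iff_map_fun_eq_pi_map hm).1 hX.indep
  rw [show (fun e : {e : Fin n × Fin n // e.1 ≤ e.2} => P.map fun ω => X ω e.1.1 e.1.2) =
    fun _ => haar p from funext fun e => (hX.law _ _ e.2).map_eq] at hlaw
  have hS := measurableSet_congrClass hA
  have h1 := (measurePreserving_symOfUpper (p := p) (n := n)).measure_preimage
    hS.nullMeasurableSet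
  rw [← hlaw, Measure.map_apply_of_aemeasurable (aemeasurable_pi_lambda _ hm)
    (continuous_symOfUpper.measurable hS)] at h1
  rw [Measure.real, Measure.real, ← h1]
  congr 2
  ext ω
  change IsCongr A (X ω) ↔ IsCongr A (symOfUpper p n fun e => X ω e.1.1 e.1.2).1
  rw [symOfUpper_entries (hX.symm ω)]

end Law

/-! ### Solving the recursion for diagonal matrices -/

section Diagonal

variable {p : ℕ} [Fact p.Prime] {ι κ : Type*} [Fintype ι] [DecidableEq ι]
  [Fintype κ] [DecidableEq κ]

/-- The density of the stabiliser of a diagonal form over `𝔽_p`. -/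
def diagStabDensity (v : ι → ZMod p) : ℝ :=
  (Nat.card {g : GL ι (ZMod p) // (g : Matrix ι ι (ZMod p)) * diagonal v *
    (g : Matrix ι ι (ZMod p))ᵀ = diagonal v} : ℝ) / (p : ℝ) ^ (Fintype.card ι).choose 2

theorem diagStabDensity_comp (e : κ ≃ ι) (v : ι → ZMod p) :
    diagStabDensity (v ∘ e) = diagStabDensity v := by
  rw [diagStabDensity, diagStabDensity, Fintype.card_congr e]
  congr 2
  refine Nat.card_congr (Equiv.subtypeEquiv
    (Units.mapEquiv (reindexAlgEquiv (ZMod p) (ZMod p) e).toMulEquiv).toEquiv fun g => ?_)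
  have hd : diagonal (v ∘ e) = (diagonal v).submatrix e e := by
    rw [submatrix_diagonal_equiv]
  have hg : (((Units.mapEquiv (reindexAlgEquiv (ZMod p) (ZMod p) e).toMulEquiv).toEquiv g :
      GL ι (ZMod p)) : Matrix ι ι (ZMod p)) = (g : Matrix κ κ (ZMod p)).submatrix e.symm e.symm :=
    rfl
  rw [hg, hd]
  constructor
  · intro h
    have := congrArg (fun M => M.submatrix e.symm e.symm) h
    simpa [← submatrix_mul_equiv _ _ _ e.symm, transpose_submatrix, Function.comp_assoc] using this
  · intro h
    have := congrArg (fun M => M.submatrix e e) h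
    simpa [← submatrix_mul_equiv _ _ _ e, transpose_submatrix] using this

theorem card_gl_congr (e : κ ≃ ι) : Nat.card (GL κ (ZMod p)) = Nat.card (GL ι (ZMod p)) :=
  Nat.card_congr (Units.mapEquiv (reindexAlgEquiv (ZMod p) (ZMod p) e).toMulEquiv).toEquiv

/-- Balance of the exponents of p in one step. On the left: the corner of the stabiliser, the number
of residues, and the normalisations of GL_b and of the stabiliser of ū. On the right: the
normalisation of GL_{a+b} and the surplus, which becomes the factor for t = 0. -/
theorem choose_two_add (a b : ℕ) :
    a * b + (a + b + 1).choose 2 + b ^ 2 + a.choose 2 = (a + b) ^ 2 + (b + 1).choose 2 := by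
  induction a with
  | zero => simp; ring
  | succ a ih =>
    have h1 : (a + 1 + b + 1).choose 2 = (a + b + 1) + (a + b + 1).choose 2 := by
      rw [show a + 1 + b + 1 = (a + b + 1) + 1 by ring, Nat.choose_succ_succ', Nat.choose_one_right]
    have h2 : (a + 1).choose 2 = a + a.choose 2 := by
      rw [Nat.choose_succ_succ', Nat.choose_one_right]
    rw [h1, h2]
    linarith [ih]

theorem density_recursion {G g d D D' x₁ x₂ x₃ x₄ x₅ x₆ : ℝ} (hg : g ≠ 0)
    (h : x₁ * x₂ * x₃ * x₄ = x₅ * x₆) :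
    G / (d * x₄ * g * x₁) / x₂ * (g / x₃ / D * D') = G / x₅ / (D * d) * (D' * x₆⁻¹) := by
  calc G / (d * x₄ * g * x₁) / x₂ * (g / x₃ / D * D') =
        G * D' * d⁻¹ * D⁻¹ * (x₁ * x₂ * x₃ * x₄)⁻¹ * (g * g⁻¹) := by
        simp only [div_eq_mul_inv, mul_inv]; ring
    _ = _ := by
        rw [h, mul_inv_cancel₀ hg]
        simp only [div_eq_mul_inv, mul_inv]; ring

/-- The Haar measure of the congruence class of a diagonal matrix. -/
theorem symHaar_congrClass_diagonal (hp : Odd p) (N : ℕ) :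
    ∀ (ι : Type) [Fintype ι] [DecidableEq ι] (k : ι → ℕ) (u : ι → ℤ_[p]),
      (∀ i, k i < N) → (∀ i, IsUnit (u i)) →
      (symHaar p ι).real (congrClass (diagonal fun i => (p : ℤ_[p]) ^ k i * u i)) =
        (Nat.card (GL ι (ZMod p)) : ℝ) / (p : ℝ) ^ (Fintype.card ι ^ 2) /
          (∏ t ∈ Finset.range N,
            diagStabDensity fun i : {i // k i = t} => PadicInt.toZMod (u i)) *
          ∏ t ∈ Finset.range N, ((p : ℝ) ^ (Fintype.card {i // t < k i} + 1).choose 2)⁻¹ := by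
  -- The induction is on a strict bound for the exponents, for all index types at once: a step
  -- passes to the indices of nonzero exponent and lowers their exponents by one. The block split
  -- off may be empty.
  induction N with
  | zero =>
    intro ι _ _ k u hk _
    have : IsEmpty ι := ⟨fun i => by simpa using hk i⟩
    have h : congrClass (diagonal fun i => (p : ℤ_[p]) ^ k i * u i) = Set.univ :=
      Set.eq_univ_of_forall fun X => by
        have : (diagonal fun i => (p : ℤ_[p]) ^ k i * u i) = X.1 := Subsingleton.elim _ _
        rw [this]
        exact IsCongr.refl _
    simp [h]
  | succ N ih =>
    intro ι _ _ k u hk hu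
    let e : {i // k i = 0} ⊕ {i // ¬ k i = 0} ≃ ι := Equiv.sumCompl fun i => k i = 0
    let v : symMat ℤ_[p] {i // k i = 0} := ⟨diagonal fun i => u i, isSymm_diagonal _⟩
    let A : symMat ℤ_[p] {i // ¬ k i = 0} :=
      ⟨diagonal fun i => (p : ℤ_[p]) ^ (k i - 1) * u i, isSymm_diagonal _⟩
    have hv : IsUnit v.1.det := by
      rw [det_diagonal]
      exact IsUnit.prod_univ_iff.2 fun i => hu i
    have hsub : (diagonal fun i => (p : ℤ_[p]) ^ k i * u i).submatrix e e =
        (symBlock v (symMulP p _ A)).1 := by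
      rw [submatrix_diagonal_equiv]
      ext i j
      rcases i with i | i <;> rcases j with j | j
      · simp [symBlock, v, e, diagonal_apply, i.2]
      · simp [symBlock]
      · simp [symBlock]
      · by_cases h : i = j
        · subst h
          simp [symBlock, A, e, symMulP, ← mul_assoc, ← pow_succ', Nat.sub_add_cancel
            (Nat.one_le_iff_ne_zero.2 i.2)]
        · simp [symBlock, A, e, symMulP, h]
    have hstep := symHaar_congrClass_symBlock hp hv A
    have hA := ih {i // ¬ k i = 0} (fun i => k i - 1) (fun i => u i)
      (fun i => by have := hk i; have := i.2; omega) fun i => hu i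
    have hdiag : (symRed p _ v).1 =
        diagonal fun i : {i // k i = 0} => PadicInt.toZMod (u i) := by
      change (diagonal fun i : {i // k i = 0} => u i).map _ = _
      rw [diagonal_map (map_zero _)]
    have hst : (Nat.card (MulAction.stabilizer (GL {i // k i = 0} (ZMod p)) (symRed p _ v)) : ℝ) =
        diagStabDensity (fun i : {i // k i = 0} => PadicInt.toZMod (u i)) *
          (p : ℝ) ^ (Fintype.card {i // k i = 0}).choose 2 := by
      rw [diagStabDensity, div_mul_cancel₀]
      · congr 1
        refine Nat.card_congr (Equiv.subtypeEquivRight fun g => ?_)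
        rw [mem_stabilizer_iff, hdiag]
      · exact pow_ne_zero _ (by exact_mod_cast (Fact.out : p.Prime).ne_zero)
    have hf : ∀ t, (diagStabDensity fun i : {i // k i = t + 1} => PadicInt.toZMod (u i)) =
        diagStabDensity fun i : {i : {i // ¬ k i = 0} // k i - 1 = t} => PadicInt.toZMod (u i) :=
      fun t => diagStabDensity_comp (κ := {i // k i = t + 1})
        (ι := {i : {i // ¬ k i = 0} // k i - 1 = t})
        ⟨fun i => ⟨⟨i.1, by rw [i.2]; omega⟩, by simp [i.2]⟩,
          fun i => ⟨i.1.1, by have := i.2; have := i.1.2; omega⟩, fun _ => rfl, fun _ => rfl⟩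
        fun i => PadicInt.toZMod (u i)
    have hc : ∀ t, Fintype.card {i // t + 1 < k i} =
        Fintype.card {i : {i // ¬ k i = 0} // t < k i - 1} := fun t =>
      Fintype.card_congr ⟨fun i => ⟨⟨i.1, by have := i.2; omega⟩, by have := i.2; grind⟩,
          fun i => ⟨i.1.1, by have := i.2; omega⟩, fun _ => rfl, fun _ => rfl⟩
    have hc0 : Fintype.card {i // 0 < k i} = Fintype.card {i // ¬ k i = 0} :=
      Fintype.card_congr (Equiv.subtypeEquivRight fun i => Nat.pos_iff_ne_zero)
    have hcard : Fintype.card ι = Fintype.card {i // k i = 0} + Fintype.card {i // ¬ k i = 0} := by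
      rw [← Fintype.card_congr e, Fintype.card_sum]
    have hmeas : (symHaar p ι).real (congrClass (diagonal fun i => (p : ℤ_[p]) ^ k i * u i)) =
        (symHaar p _).real (congrClass (symBlock v (symMulP p _ A)).1) := by
      rw [Measure.real, Measure.real, ← hsub, symHaar_congrClass_submatrix e (isSymm_diagonal _)]
    have hA' : (symHaar p {i // ¬ k i = 0}).real (congrClass A.1) = _ := hA
    -- The factors at t = 0 come from the block just removed; those at t + 1 match level t of the
    -- lowered exponents.
    rw [hmeas, hstep, hst, hA', Finset.prod_range_succ', Finset.prod_range_succ', hc0, hcard,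
      card_gl_congr e]
    simp only [hf, hc]
    set a := Fintype.card {i // k i = 0}
    set b := Fintype.card {i // ¬ k i = 0}
    have hp0 : (p : ℝ) ≠ 0 := by exact_mod_cast (Fact.out : p.Prime).ne_zero
    have hexp : (p : ℝ) ^ (a * b) * p ^ (a + b + 1).choose 2 * p ^ (b ^ 2) * p ^ a.choose 2 =
        p ^ ((a + b) ^ 2) * p ^ (b + 1).choose 2 := by
      rw [← pow_add, ← pow_add, ← pow_add, ← pow_add, choose_two_add]
    have hg : (Nat.card (GL {i // ¬ k i = 0} (ZMod p)) : ℝ) ≠ 0 := by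
      exact_mod_cast Nat.card_pos.ne'
    exact density_recursion hg hexp

end Diagonal

/-! ### Canonical signatures and the exponent of p -/

section Canonical

variable {p : ℕ} [Fact p.Prime] {n : ℕ}

theorem orthDensity_eq_diagStabDensity (r : ℤ_[p]) (m : ℕ) (s : ℤˣ) :
    orthDensity p r m s =
      diagStabDensity fun i : Fin m =>
        if s = -1 ∧ (i : ℕ) + 1 = m then PadicInt.toZMod r else 1 := by
  rw [orthDensity, diagStabDensity, Fintype.card_fin, Nat.choose_two_right]
  rfl

theorem orthDensity_zero (r : ℤ_[p]) (s : ℤˣ) : orthDensity p r 0 s = 1 := by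
  simp [orthDensity]

/-- The diagonal entries of the canonical matrix of signatures. -/
def signatureEntry (r : ℤ_[p]) (k : Fin n → ℕ) (s : ℕ → ℤˣ) (i : Fin n) : ℤ_[p] :=
  if s (k i) = -1 ∧ ∀ j, k j = k i → j ≤ i then r else 1

theorem divisorMatrix_mul_signatureMatrix (r : ℤ_[p]) (k : Fin n → ℕ) (s : ℕ → ℤˣ) :
    divisorMatrix p k * signatureMatrix r k s =
      diagonal fun i => (p : ℤ_[p]) ^ k i * signatureEntry r k s i := by
  rw [divisorMatrix, signatureMatrix, diagonal_mul_diagonal]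
  rfl

/-- The increasing enumeration of the indices with k i = t identifies the block with `Fin (mult k
t)` and sends the last position of one to that of the other, so r sits in the same place. -/
theorem diagStabDensity_signatureEntry (r : ℤ_[p]) (k : Fin n → ℕ) (s : ℕ → ℤˣ) (t : ℕ) :
    (diagStabDensity fun i : {i // k i = t} => PadicInt.toZMod (signatureEntry r k s i)) =
      orthDensity p r (mult k t) (s t) := by
  let S : Finset (Fin n) := Finset.univ.filter fun i => k i = t
  let o : Fin (mult k t) ≃o S := S.orderIsoOfFin rfl
  let e : Fin (mult k t) ≃ {i // k i = t} :=
    o.toEquiv.trans (Equiv.subtypeEquivRight fun i => by simp [S])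
  rw [orthDensity_eq_diagStabDensity, ← diagStabDensity_comp e]
  congr 1
  ext i
  have hk : k (e i) = t := (e i).2
  have hlast : (∀ j, k j = t → j ≤ (e i : Fin n)) ↔ (i : ℕ) + 1 = mult k t := by
    constructor
    · intro h
      by_contra hne
      have hlt : (i : ℕ) + 1 < mult k t := lt_of_le_of_ne i.2 hne
      have h1 : o ⟨i + 1, hlt⟩ ≤ o i := h _ (e ⟨i + 1, hlt⟩).2
      have h2 := o.le_iff_le.1 h1
      simp [Fin.le_def] at h2
    · intro h j hj
      have h1 : o.symm ⟨j, by simp [S, hj]⟩ ≤ i := by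
        have := (o.symm ⟨j, by simp [S, hj]⟩).2
        rw [Fin.le_def]; omega
      exact (o.symm_apply_le).1 h1
  simp only [Function.comp_apply, signatureEntry, hk, hlast]
  split_ifs <;> simp

/-- By monotonicity the indices with t < k j are the last M ones, for which n − j runs through M, …,
1 (j counted from 0). The induction drops the first index: if it satisfies t < k 0, so do all the
others. -/
theorem choose_two_card_eq_sum {n : ℕ} (k : Fin n → ℕ) (hk : Monotone k) (t : ℕ) :
    (Fintype.card {i // t < k i} + 1).choose 2 = ∑ j : Fin n, if t < k j then n - (j : ℕ) else 0 := by
  induction n with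
  | zero => simp
  | succ n ih =>
    have h := ih (fun i => k i.succ) fun i j hij => hk (Fin.succ_le_succ_iff.2 hij)
    rw [Fintype.card_subtype, Finset.card_filter] at h ⊢
    rw [Fin.sum_univ_succ, Fin.sum_univ_succ]
    simp only [Fin.val_succ, Nat.add_sub_add_right, ← h, Fin.val_zero, Nat.sub_zero]
    by_cases h0 : t < k 0
    · have hall : ∀ i : Fin n, t < k i.succ := fun i => h0.trans_le (hk (Fin.zero_le _))
      simp only [h0, hall, if_true, Finset.sum_const, Finset.card_univ, Fintype.card_fin,
        smul_eq_mul, mul_one]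
      rw [Nat.choose_succ_succ', Nat.choose_one_right, add_comm 1 n]
    · simp [h0]

/-- Exchange of summations: each j is counted once for every t < k j, that is k j times. -/
theorem sum_choose_two_card {n : ℕ} (k : Fin n → ℕ) (hk : Monotone k) {N : ℕ}
    (hN : ∀ i, k i < N) :
    ∑ t ∈ Finset.range N, (Fintype.card {i // t < k i} + 1).choose 2 =
      ∑ j : Fin n, k j * (n - (j : ℕ)) := by
  simp only [choose_two_card_eq_sum k hk]
  rw [Finset.sum_comm]
  refine Finset.sum_congr rfl fun j _ => ?_
  rw [← Finset.sum_filter, Finset.sum_const, smul_eq_mul]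
  congr 1
  have : (Finset.range N).filter (fun t => t < k j) = Finset.range (k j) := by
    ext t
    have := hN j
    simp only [Finset.mem_filter, Finset.mem_range]
    omega
  rw [this, Finset.card_range]

end Canonical

end PadicSymm

end

theorem theorem1p1 (p : ℕ) [Fact p.Prime] (hp : Odd p)
    (r : ℤ_[p]) (hr : IsUnit r) (hr' : ¬ IsSquare r)
    (n : ℕ) {Ω : Type*} [MeasurableSpace Ω] (P : Measure Ω) [IsProbabilityMeasure P]
    (X : Ω → Matrix (Fin n) (Fin n) ℤ_[p]) (hX : PadicSymm.IsHaarSymmetric X P)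
    (k : Fin n → ℕ) (hk : Monotone k)
    (s : ℕ → ℤˣ) (hs : ∀ t, PadicSymm.mult k t = 0 → s t = 1) :
    P.real {ω | X ω ∈ PadicSymm.congrOrbit
        (PadicSymm.divisorMatrix p k * PadicSymm.signatureMatrix r k s)} =
      PadicSymm.glDensity p n /
          (∏ᶠ t : ℕ, PadicSymm.orthDensity p r (PadicSymm.mult k t) (s t)) *
        ∏ j : Fin n, ((p : ℝ) ^ (k j * (n - (j : ℕ))))⁻¹ := by
  obtain ⟨N, hN⟩ : ∃ N, ∀ i, k i < N :=
    ⟨∑ i, k i + 1, fun i => Nat.lt_succ_of_le (Finset.single_le_sum (f := k)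
      (fun _ _ => Nat.zero_le _) (Finset.mem_univ i))⟩
  have hunit : ∀ i, IsUnit (PadicSymm.signatureEntry r k s i) := fun i => by
    unfold PadicSymm.signatureEntry
    split_ifs
    exacts [hr, isUnit_one]
  -- For t ≥ N the block is empty, and the density of an empty block is 1 whatever its sign, so the
  -- product is finite.
  have hfin : ∏ᶠ t : ℕ, PadicSymm.orthDensity p r (PadicSymm.mult k t) (s t) =
      ∏ t ∈ Finset.range N, PadicSymm.orthDensity p r (PadicSymm.mult k t) (s t) := by
    refine finprod_eq_prod_of_mulSupport_subset _ fun t ht => ?_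
    rw [Finset.coe_range, Set.mem_Iio]
    by_contra hle
    refine ht ?_
    have : PadicSymm.mult k t = 0 := by
      rw [PadicSymm.mult, Finset.card_eq_zero, Finset.filter_eq_empty_iff]
      intro i _ hi
      exact hle (hi ▸ hN i)
    simp only [this, PadicSymm.orthDensity_zero]
  rw [PadicSymm.divisorMatrix_mul_signatureMatrix, hX.real_congrOrbit (isSymm_diagonal _),
    PadicSymm.symHaar_congrClass_diagonal hp N (Fin n) k _ hN hunit, hfin]
  simp only [PadicSymm.diagStabDensity_signatureEntry]
  rw [PadicSymm.glDensity, Fintype.card_fin, Finset.prod_inv_distrib, Finset.prod_inv_distrib,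
    Finset.prod_pow_eq_pow_sum, Finset.prod_pow_eq_pow_sum, PadicSymm.sum_choose_two_card k hk hN]
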